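/- Let $R$ be a finite reduced crystallographic root system (not necessarily irreducible), with roots spanning $\mathfrak h^*$ and coroots spanning $\mathfrak h$, where $\mathfrak h$ is a finite-dimensional complex vector space, for example the root system of a complex simple Lie algebra with Cartan subalgebra $\mathfrak h$. Let $W$ be its Weyl group, acting on $\mathfrak h$ by the reflection representation. For $w \in W$ let $\mathrm{cl}_W(w)$ be the largest integer $k \ge 1$ such that the cyclotomic polynomial $\Phi_k$ divides the characteristic polynomial of $w$ on $\mathfrak h$; this depends only on the conjugacy class of $w$. A vector of $\mathfrak h$ is regular if no root vanishes on it, and an element of $W$ is regular if it has a regular eigenvector in $\mathfrak h$. A positive integer $m$ is a regular number of $W$ if $W$ contains a regular element of order $m$. Let $m$ be a regular number of $W$, and let $W[m]$ denote a conjugacy class of $W$ consisting of regular elements of order $m$ (by a theorem of Springer there is only one). Then such a class exists, and for every such class $$\mathrm{cl}_W(W[m]) = m.$$ -/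

import Mathlib

namespace CycLevel

noncomputable section

section

variable {ι M N : Type*} [AddCommGroup M] [Module ℂ M] [AddCommGroup N] [Module ℂ N]

/-- The reflection representation of the Weyl group of a root system `P`. The roots of `P` lie in
`M = 𝔥*` and the coroots in `N = 𝔥`; an element `w` acts on `𝔥` by the inverse of the transpose of
its action on `𝔥*`, so that the reflection in a root `α` acts by `h ↦ h - α(h) α^∨`. -/
def reflRep (P : RootPairing ι ℂ M N) : P.weylGroup →* (N ≃ₗ[ℂ] N) where
  toFun w := MulOpposite.unop (RootPairing.Equiv.coweightHom P (w : P.Aut)⁻¹)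
  map_one' := by
    rw [OneMemClass.coe_one, inv_one, map_one, MulOpposite.unop_one]
  map_mul' x y := by
    rw [Subgroup.coe_mul, mul_inv_rev, map_mul, MulOpposite.unop_mul]

/-- A vector of `𝔥` is regular if it lies on no reflection hyperplane, i.e. no root vanishes
on it. -/
def IsRegularVector (P : RootPairing ι ℂ M N) (v : N) : Prop :=
  ∀ i, P.root' i v ≠ 0

/-- An element of the Weyl group is regular if it has a regular eigenvector in the (complex)
reflection representation. -/
def IsRegularElement (P : RootPairing ι ℂ M N) (w : P.weylGroup) : Prop :=
  ∃ (v : N) (μ : ℂ), IsRegularVector P v ∧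
    Module.End.HasEigenvector (reflRep P w : N →ₗ[ℂ] N) μ v

/-- A positive integer `m` is a regular number for the Weyl group if some element of order `m` is
regular. -/
def IsRegularNumber (P : RootPairing ι ℂ M N) (m : ℕ) : Prop :=
  0 < m ∧ ∃ w : P.weylGroup, orderOf w = m ∧ IsRegularElement P w

/-- The conjugacy class `C` of the Weyl group consists of regular elements of order `m`, i.e. it
is the class `W[m]`. -/
def IsRegularClass (P : RootPairing ι ℂ M N) (m : ℕ) (C : ConjClasses P.weylGroup) : Prop :=
  ∀ w ∈ C.carrier, orderOf w = m ∧ IsRegularElement P w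

variable [FiniteDimensional ℂ N]

/-- The characteristic polynomial of `w` on the reflection representation. -/
def charp (P : RootPairing ι ℂ M N) (w : P.weylGroup) : Polynomial ℂ :=
  (reflRep P w : N →ₗ[ℂ] N).charpoly

/-- The cyclotomic level of `w`: the largest `k ≥ 1` such that the `k`-th cyclotomic polynomial
divides the characteristic polynomial of `w`. (A positive value of `sSup` on a set of natural
numbers is attained: `sSup` is `0` on empty and on unbounded sets.) -/
def clW (P : RootPairing ι ℂ M N) (w : P.weylGroup) : ℕ :=
  sSup {k : ℕ | 1 ≤ k ∧ Polynomial.cyclotomic k ℂ ∣ charp P w}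

theorem charp_conj (P : RootPairing ι ℂ M N) {w w' : P.weylGroup} (h : IsConj w w') :
    charp P w = charp P w' := by
  obtain ⟨c, rfl⟩ := isConj_iff.mp h
  have := LinearEquiv.charpoly_conj (reflRep P c) (reflRep P w : N →ₗ[ℂ] N)
  rw [charp, charp, ← this]
  congr 1
  rw [map_mul, map_mul, map_inv]
  rfl

/-- The cyclotomic level as a function on conjugacy classes. -/
def clConj (P : RootPairing ι ℂ M N) : ConjClasses P.weylGroup → ℕ :=
  Quotient.lift (clW P) fun w w' (h : IsConj w w') => by
    simp only [clW, charp_conj P h]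

end

end

end CycLevel

/-!
The theorem rests on two facts about the Weyl group `W`.

* `W` acts freely on regular vectors (`eq_one_of_reflRep_eq_self`). If `w` fixes a regular `v`,
  then `w` preserves the function `α ↦ α(v)` on the roots. A `ℚ`-linear functional on `ℂ` that is
  nonzero on the finitely many values `α(v)` turns this function into one defining a positive
  system, and `w` preserves that system. By the exchange condition
  (`exists_word_eq_mul_reflection`) a nonempty word of minimal length in the simple reflections
  makes some simple root negative, so `w = 1`.
* The characteristic polynomial of `w` has integer coefficients (`exists_int_charp`), because `w`
  permutes the coroots and these are integral combinations of the simple coroots.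

Let `w` be regular of order `m`, with regular eigenvector `v` and eigenvalue `μ`. If `μ ^ l = 1`
then `w ^ l` fixes `v`, so `w ^ l = 1`; hence `μ` is a primitive `m`-th root of unity, and its
minimal polynomial `Φ_m` over `ℤ` divides the characteristic polynomial. Conversely, if `Φ_k`
divides the characteristic polynomial, then a primitive `k`-th root of unity is an eigenvalue of
`w`, and `w ^ m = 1` forces `k ∣ m`. So `m` is the largest such `k`.
-/

namespace CycLevel

open RootPairing Polynomial

/-! ### Words in reflections and the exchange condition -/

section Words

variable {ι R M N : Type*} [Field R] [AddCommGroup M] [Module R M]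
  [AddCommGroup N] [Module R N]

/-- The product of the reflections in the roots indexed by the entries of `l`, in order. The list
is arbitrary; it is a word in the simple reflections when its entries lie in the support of a
base. -/
noncomputable def word (P : RootPairing ι R M N) (l : List ι) : P.Aut :=
  (l.map (Equiv.reflection P)).prod

@[simp] lemma word_nil (P : RootPairing ι R M N) : word P [] = 1 := rfl

@[simp] lemma word_cons (P : RootPairing ι R M N) (i : ι) (l : List ι) :
    word P (i :: l) = Equiv.reflection P i * word P l := by
  simp [word]

lemma word_append (P : RootPairing ι R M N) (l l' : List ι) :
    word P (l ++ l') = word P l * word P l' := by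
  simp [word]

@[simp] lemma reflection_smul_index (P : RootPairing ι R M N) (i j : ι) :
    Equiv.reflection P i • j = P.reflectionPerm i j := rfl

lemma root_smul_index (P : RootPairing ι R M N) (w : P.Aut) (i : ι) :
    P.root (w • i) = w • P.root i :=
  RootPairing.Equiv.root_indexEquiv_eq_smul P i w

lemma reflection_reflectionPerm_eq_conj (P : RootPairing ι R M N) (i j : ι) :
    Equiv.reflection P (P.reflectionPerm i j) =
      Equiv.reflection P i * Equiv.reflection P j * (Equiv.reflection P i)⁻¹ := by
  apply Equiv.weightHom_injective P
  rw [map_mul, map_mul, Equiv.reflection_inv]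
  simp only [Equiv.weightHom_apply, Equiv.reflection_weightEquiv]
  rw [reflection_reflectionPerm]

lemma reflection_word_smul (P : RootPairing ι R M N) (l : List ι) (i : ι) :
    Equiv.reflection P (word P l • i) = word P l * Equiv.reflection P i * (word P l)⁻¹ := by
  induction l with
  | nil => simp
  | cons a l ih =>
    rw [word_cons, mul_smul, reflection_smul_index, reflection_reflectionPerm_eq_conj, ih]
    group

variable [CharZero R] [Finite ι] {P : RootPairing ι R M N} [P.IsCrystallographic] [P.IsReduced] (b : P.Base)

/-- The Weyl group is generated by the simple reflections. -/
lemma exists_word_eq {w : P.Aut} (hw : w ∈ P.weylGroup) :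
    ∃ l : List ι, (∀ i ∈ l, i ∈ b.support) ∧ word P l = w := by
  have hmul : ∀ x y : P.Aut,
      (∃ l : List ι, (∀ i ∈ l, i ∈ b.support) ∧ word P l = x) →
      (∃ l : List ι, (∀ i ∈ l, i ∈ b.support) ∧ word P l = y) →
      ∃ l : List ι, (∀ i ∈ l, i ∈ b.support) ∧ word P l = x * y := by
    rintro x y ⟨l, hl, rfl⟩ ⟨l', hl', rfl⟩
    exact ⟨l ++ l', by grind, word_append P l l'⟩
  have hsimple : ∀ i ∈ b.support,
      ∃ l : List ι, (∀ i ∈ l, i ∈ b.support) ∧ word P l = Equiv.reflection P i :=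
    fun i hi ↦ ⟨[i], by simpa, by simp⟩
  induction hw using weylGroup.induction with
  | one => exact ⟨[], by simp, rfl⟩
  | mul x y _ _ hx hy => exact hmul x y hx hy
  | mem i =>
    induction i using b.induction_reflect with
    | h₀ i hi => rwa [reflection_reflectionPerm_eq_conj, mul_inv_cancel_right]
    | h₁ i hi => exact hsimple i hi
    | h₂ i j hi hj =>
      rw [reflection_reflectionPerm_eq_conj, Equiv.reflection_inv]
      exact hmul _ _ (hmul _ _ (hsimple j hj) hi) (hsimple j hj)

/-- The exchange condition, for words that need not be reduced: if a word in the simple reflections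
sends the simple root `j` to a negative root, then multiplying it on the right by the reflection in
`j` amounts to deleting one of its letters. -/
lemma exists_word_eq_mul_reflection {l : List ι} (hl : ∀ i ∈ l, i ∈ b.support) {j : ι}
    (hj : j ∈ b.support) (h : ¬ b.IsPos (word P l • j)) :
    ∃ l' : List ι, (∀ i ∈ l', i ∈ b.support) ∧ l'.length < l.length ∧
      word P l' = word P l * Equiv.reflection P j := by
  induction l with
  | nil => exact absurd (b.isPos_of_mem_support hj) (by simpa using h)
  | cons a l ih =>
    have hla : ∀ i ∈ l, i ∈ b.support := fun i hi ↦ hl i (by simp [hi])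
    by_cases hk : b.IsPos (word P l • j)
    -- The reflection in `a` makes the positive root `word P l • j` negative, so that root is `a`,
    -- and the letter to delete is this `a`.
    · have hka : word P l • j = a := by
        by_contra hne
        rw [word_cons, mul_smul, reflection_smul_index] at h
        exact h (hk.reflectionPerm (hl a (by simp)) hne)
      refine ⟨l, hla, by simp, ?_⟩
      have hconj := reflection_word_smul P l j
      rw [hka] at hconj
      have hsq : Equiv.reflection P j * Equiv.reflection P j = 1 := by
        rw [mul_eq_one_iff_inv_eq, Equiv.reflection_inv]
      rw [word_cons, hconj, inv_mul_cancel_right, mul_assoc, hsq, mul_one]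
    · obtain ⟨l', hl', hlen, heq⟩ := ih hla hk
      refine ⟨a :: l', ?_, by simpa, ?_⟩
      · simpa using ⟨hl a (by simp), hl'⟩
      · rw [word_cons, word_cons, heq, mul_assoc]

/-- An element of the Weyl group that preserves the positive roots of a base is trivial. -/
lemma eq_one_of_isPos_smul {w : P.Aut} (hw : w ∈ P.weylGroup)
    (h : ∀ i, b.IsPos i → b.IsPos (w • i)) : w = 1 := by
  obtain ⟨l, hl, rfl⟩ := exists_word_eq b hw
  clear hw
  induction hn : l.length using Nat.strong_induction_on generalizing l with
  | h n ih =>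
    rcases l.eq_nil_or_concat' with rfl | ⟨t, j, rfl⟩
    · rfl
    · have hj : j ∈ b.support := hl j (by simp)
      have ht : ∀ i ∈ t, i ∈ b.support := fun i hi ↦ hl i (by simp [hi])
      -- `word P t • j` is the negative of the image of `j` under the whole word.
      have hneg : ¬ b.IsPos (word P t • j) := by
        intro hpos
        have h1 := h j (b.isPos_of_mem_support hj)
        rw [word_append, word_cons, word_nil, mul_one, mul_smul, reflection_smul_index] at h1
        have h2 : word P t • P.reflectionPerm j j =
            P.reflectionPerm (word P t • j) (word P t • j) := by
          apply P.root.injective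
          rw [root_smul_index, root_reflectionPerm, root_reflectionPerm, reflection_apply_self,
            reflection_apply_self, root_smul_index, smul_neg]
        rw [h2] at h1
        exact (Base.IsPos.neg_iff_not b _).mp h1 hpos
      obtain ⟨t', ht', hlen, heq⟩ := exists_word_eq_mul_reflection b ht hj hneg
      have hw : word P (t ++ [j]) = word P t' := by
        rw [word_append, heq, word_cons, word_nil, mul_one]
      rw [hw] at h ⊢
      exact ih t'.length (by simp at hn; omega) t' ht' h rfl

end Words

/-! ### Positive systems defined by a functional -/

section Positivity

variable {ι R M N : Type*} [Finite ι] [Field R] [CharZero R] [AddCommGroup M] [Module R M]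
  [AddCommGroup N] [Module R N] (P : RootPairing ι R M N)
  [P.IsRootSystem] [P.IsCrystallographic] [P.IsReduced]

/-- Every functional that vanishes on no root is positive exactly on the positive roots of some
base. -/
lemma exists_base_isPos_iff (f : M →+ ℚ) (hf : ∀ i, f (P.root i) ≠ 0) :
    ∃ b : P.Base, ∀ i, b.IsPos i ↔ 0 < f (P.root i) := by
  let := P.indexNeg
  let b : P.Base := Base.mk' P (IsAddIndecomposable.baseOf P.root f)
    (P.linearIndepOn_root_baseOf f hf)
    (fun i ↦ IsAddIndecomposable.mem_or_neg_mem_closure_baseOf P.root f i (hf i) (by simp))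
  have hsupp : ∀ i ∈ b.support, 0 < f (P.root i) := fun i hi ↦
    IsAddIndecomposable.baseOf_subset_pos P.root f (by simpa [b, Base.mk'] using hi)
  have hpos : ∀ i, b.IsPos i → 0 < f (P.root i) := fun i hi ↦ by
    refine hi.induction_on_add (p := fun i ↦ 0 < f (P.root i)) hsupp fun i j k hk hi hj ↦ ?_
    rw [hk, map_add]
    exact add_pos hi (hsupp j hj)
  refine ⟨b, fun i ↦ ⟨hpos i, fun hi ↦ ?_⟩⟩
  by_contra hneg
  have := hpos _ ((Base.IsPos.neg_iff_not b i).mpr hneg)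
  rw [indexNeg_neg, root_reflectionPerm, reflection_apply_self, map_neg] at this
  linarith

lemma eq_one_of_root_smul_eq {w : P.Aut} (hw : w ∈ P.weylGroup) (f : M →+ ℚ)
    (hf : ∀ i, f (P.root i) ≠ 0) (h : ∀ i, f (P.root (w • i)) = f (P.root i)) : w = 1 := by
  obtain ⟨b, hb⟩ := exists_base_isPos_iff P f hf
  exact eq_one_of_isPos_smul b hw fun i hi ↦ by rwa [hb, h, ← hb]

end Positivity

/-! ### Regular elements in the reflection representation -/

section Regular

variable {ι M N : Type*} [AddCommGroup M] [Module ℂ M] [AddCommGroup N] [Module ℂ N]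
  (P : RootPairing ι ℂ M N)

/-- `reflRep P w` is contragredient to the action of `w` on `M`. -/
lemma toLinearMap_reflRep (w : P.weylGroup) (x : M) (v : N) :
    P.toLinearMap x (reflRep P w v) = P.toLinearMap ((w⁻¹ : P.Aut) • x) v :=
  (congrArg (fun g ↦ g x) (Hom.weight_coweight_transpose_apply P P v (w⁻¹ : P.Aut).toHom)).symm

lemma reflRep_coroot (w : P.weylGroup) (i : ι) :
    reflRep P w (P.coroot i) = P.coroot ((w : P.Aut) • i) :=
  Hom.coroot_coweightMap_apply P P i (w⁻¹ : P.Aut).toHom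

lemma IsRegularVector.reflRep {P : RootPairing ι ℂ M N} {v : N} (hv : IsRegularVector P v)
    (w : P.weylGroup) : IsRegularVector P (reflRep P w v) := by
  intro i
  have := hv ((w⁻¹ : P.Aut) • i)
  rw [RootPairing.root', root_smul_index] at this
  rwa [RootPairing.root', toLinearMap_reflRep]

lemma IsRegularElement.conj {P : RootPairing ι ℂ M N} {w w' : P.weylGroup}
    (hw : IsRegularElement P w) (h : IsConj w w') : IsRegularElement P w' := by
  obtain ⟨c, rfl⟩ := isConj_iff.mp h
  obtain ⟨v, μ, hv, hμ⟩ := hw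
  refine ⟨CycLevel.reflRep P c v, μ, hv.reflRep c, ?_, ?_⟩
  · rw [Module.End.mem_eigenspace_iff]
    have h1 := hμ.apply_eq_smul
    simp only [LinearEquiv.coe_coe] at h1 ⊢
    rw [← LinearEquiv.mul_apply, ← map_mul, inv_mul_cancel_right, map_mul, LinearEquiv.mul_apply,
      h1, map_smul]
  · simpa using hμ.2

lemma reflRep_pow_apply (w : P.weylGroup) {μ : ℂ} {v : N} (h : reflRep P w v = μ • v) (n : ℕ) :
    reflRep P (w ^ n) v = μ ^ n • v := by
  induction n with
  | zero => simp
  | succ n ih =>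
    rw [pow_succ, map_mul, LinearEquiv.mul_apply, h, map_smul, ih, smul_smul, pow_succ']

/-- The Weyl group acts freely on the regular vectors. -/
lemma eq_one_of_reflRep_eq_self [Finite ι] [P.IsRootSystem] [P.IsCrystallographic] [P.IsReduced]
    {w : P.weylGroup} {v : N} (hv : IsRegularVector P v) (h : reflRep P w v = v) : w = 1 := by
  -- Over `ℂ` the values of the roots at `v` have no sign; a generic `ℚ`-linear functional gives
  -- them one while staying compatible with the addition of roots.
  obtain ⟨f, hf⟩ : ∃ f : Module.Dual ℚ ℂ, ∀ i, f (P.root' i v) ≠ 0 :=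
    Module.exists_dual_forall_apply_ne_zero (fun i ↦ P.root' i v) hv
  let F : M →+ ℚ := (f : ℂ →+ ℚ).comp ((P.toLinearMap.flip v : M →ₗ[ℂ] ℂ) : M →+ ℂ)
  apply Subtype.ext
  refine eq_one_of_root_smul_eq P w.2 F hf fun i ↦ ?_
  have h1 := toLinearMap_reflRep P w ((w : P.Aut) • P.root i) v
  rw [h, inv_smul_smul] at h1
  rw [root_smul_index]
  exact congrArg f h1

/-- The eigenvalue of `w` on a regular eigenvector has the same order as `w`. -/
lemma isPrimitiveRoot_of_regular [Finite ι] [P.IsRootSystem] [P.IsCrystallographic] [P.IsReduced]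
    {w : P.weylGroup} {v : N} {μ : ℂ} (hv : IsRegularVector P v) (hv0 : v ≠ 0)
    (h : reflRep P w v = μ • v) : IsPrimitiveRoot μ (orderOf w) where
  pow_eq_one := by
    have h1 := reflRep_pow_apply P w h (orderOf w)
    rw [pow_orderOf_eq_one, map_one, LinearEquiv.coe_one, id] at h1
    exact (smul_left_injective ℂ hv0 (by simpa using h1)).symm
  dvd_of_pow_eq_one l hl := by
    refine orderOf_dvd_of_pow_eq_one (eq_one_of_reflRep_eq_self P hv ?_)
    rw [reflRep_pow_apply P w h, hl, one_smul]

variable [FiniteDimensional ℂ N]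

/-- The characteristic polynomial is integral, since in a basis of simple coroots the matrix of `w`
has integer entries. -/
lemma exists_int_charp [Finite ι] [P.IsRootSystem] [P.IsCrystallographic] [P.IsReduced]
    (w : P.weylGroup) : ∃ p : ℤ[X], p.map (Int.castRingHom ℂ) = charp P w := by
  classical
  obtain ⟨b⟩ := P.nonempty_base
  have hrepr : ∀ i j, ∃ z : ℤ, (z : ℂ) = b.toCoweightBasis.repr (P.coroot i) j := by
    intro i j
    have hi := b.coroot_mem_span_int i
    generalize P.coroot i = y at hi
    induction hi using Submodule.span_induction with
    | mem x hx =>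
      obtain ⟨k, hk, rfl⟩ := hx
      refine ⟨Finsupp.single (⟨k, hk⟩ : b.support) (1 : ℤ) j, ?_⟩
      rw [b.toCoweightBasis_repr_coroot ⟨k, hk⟩, Finsupp.single_apply, Finsupp.single_apply]
      split_ifs <;> simp
    | zero => exact ⟨0, by simp⟩
    | add x y _ _ hx hy =>
      obtain ⟨z, hz⟩ := hx
      obtain ⟨z', hz'⟩ := hy
      exact ⟨z + z', by simp [hz, hz']⟩
    | smul a x _ hx =>
      obtain ⟨z, hz⟩ := hx
      exact ⟨a * z, by simp [hz, ← Int.cast_smul_eq_zsmul ℂ]⟩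
  choose c hc using hrepr
  -- Column `i` of the matrix holds the coordinates of the image of the simple coroot `i`.
  let A : Matrix b.support b.support ℤ := .of fun j i ↦ c ((w : P.Aut) • (i : ι)) j
  refine ⟨A.charpoly, ?_⟩
  rw [charp, ← LinearMap.charpoly_toMatrix _ b.toCoweightBasis, ← Matrix.charpoly_map]
  congr 1
  ext j i
  rw [LinearMap.toMatrix_apply, b.toCoweightBasis_apply, LinearEquiv.coe_coe, reflRep_coroot]
  exact hc _ j

lemma cyclotomic_dvd_charp [Finite ι] [P.IsRootSystem] [P.IsCrystallographic] [P.IsReduced]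
    {w : P.weylGroup} {μ : ℂ} {n : ℕ} (hn : 0 < n) (hμ : IsPrimitiveRoot μ n)
    (h : (charp P w).IsRoot μ) : cyclotomic n ℂ ∣ charp P w := by
  obtain ⟨p, hp⟩ := exists_int_charp P w
  rw [← hp, ← map_cyclotomic n (Int.castRingHom ℂ)]
  refine Polynomial.map_dvd _ ?_
  rw [cyclotomic_eq_minpoly hμ hn]
  refine minpoly.isIntegrallyClosed_dvd (hμ.isIntegral hn) ?_
  rw [← hp, IsRoot.def, eval_map] at h
  exact h

lemma dvd_orderOf_of_cyclotomic_dvd {w : P.weylGroup} {k : ℕ} (hk : 0 < k)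
    (h : cyclotomic k ℂ ∣ charp P w) : k ∣ orderOf w := by
  have hζ := Complex.isPrimitiveRoot_exp k hk.ne'
  have hroot : (charp P w).IsRoot _ := (hζ.isRoot_cyclotomic hk).dvd h
  obtain ⟨v, hv⟩ :=
    ((Module.End.hasEigenvalue_iff_isRoot_charpoly _ _).mpr hroot).exists_hasEigenvector
  have h1 := reflRep_pow_apply P w hv.apply_eq_smul (orderOf w)
  rw [pow_orderOf_eq_one, map_one, LinearEquiv.coe_one, id] at h1
  exact hζ.dvd_of_pow_eq_one _ (smul_left_injective ℂ hv.2 (by simpa using h1)).symm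

lemma clW_eq_orderOf [Finite ι] [P.IsRootSystem] [P.IsCrystallographic] [P.IsReduced]
    {w : P.weylGroup} (hw : IsRegularElement P w) (hpos : 0 < orderOf w) :
    clW P w = orderOf w := by
  obtain ⟨v, μ, hv, hμ⟩ := hw
  have hprim := isPrimitiveRoot_of_regular P hv hμ.2 hμ.apply_eq_smul
  have hroot : (charp P w).IsRoot μ := (Module.End.hasEigenvalue_iff_isRoot_charpoly _ _).mp
    (Module.End.hasEigenvalue_of_hasEigenvector hμ)
  refine IsGreatest.csSup_eq ⟨⟨hpos, cyclotomic_dvd_charp P hpos hprim hroot⟩, ?_⟩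
  rintro k ⟨hk, hdvd⟩
  exact Nat.le_of_dvd hpos (dvd_orderOf_of_cyclotomic_dvd P hk hdvd)

end Regular

end CycLevel

theorem lemma3p5 {ι M N : Type*} [Finite ι]
    [AddCommGroup M] [Module ℂ M] [AddCommGroup N] [Module ℂ N] [FiniteDimensional ℂ N]
    (P : RootPairing ι ℂ M N) [P.IsRootSystem] [P.IsCrystallographic] [P.IsReduced]
    (m : ℕ) (hm : CycLevel.IsRegularNumber P m) :
    (∃ C : ConjClasses P.weylGroup, CycLevel.IsRegularClass P m C) ∧
      ∀ C : ConjClasses P.weylGroup, CycLevel.IsRegularClass P m C → CycLevel.clConj P C = m := by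
  obtain ⟨hpos, w, hwm, hw⟩ := hm
  refine ⟨⟨ConjClasses.mk w, fun w' hw' ↦ ?_⟩, fun C hC ↦ ?_⟩
  · have hconj : IsConj w w' := 
      (ConjClasses.mk_eq_mk_iff_isConj.mp (ConjClasses.mem_carrier_iff_mk_eq.mp hw')).symm
    obtain ⟨c, hc⟩ := hconj
    exact ⟨hwm ▸ (hc.orderOf_eq _).symm, hw.conj ⟨c, hc⟩⟩
  · obtain ⟨w', rfl⟩ := ConjClasses.exists_rep C
    obtain ⟨hord, hreg⟩ := hC w' ConjClasses.mem_carrier_mk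
    rw [← hord] at hpos ⊢
    exact CycLevel.clW_eq_orderOf P hreg hpos
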